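/- Let $\mathcal{R}$ be a $\kappa$-saturated o-minimal expansion of a real closed field $R$, where $\kappa$ is an uncountable cardinal; "definable" means definable in $\mathcal{R}$ with parameters, and a set $X\subseteq R^n$ is *type-definable* if it is the set of realizations of a partial type over a parameter set of cardinality less than $\kappa$. A *locally definable group* is a group whose underlying set $\mathcal{U}\subseteq R^n$ is the union of a countable directed family $(X_i)$ of definable sets such that the restriction of the multiplication to each $X_i\times X_j$ is a definable map. For a subgroup $\mathcal{G}$ of a locally definable group, $\mathcal{G}^{00}$ denotes the smallest type-definable subgroup of $\mathcal{G}$ of index less than $\kappa$; we say that $\mathcal{G}^{00}$ exists if there is such a smallest subgroup. A definable set $X\subseteq\mathcal{G}$ is *generic* in $\mathcal{G}$ if $\mathcal{G}$ is covered by fewer than $\kappa$ left translates of $X$ by elements of $\mathcal{G}$ and also by fewer than $\kappa$ right translates. A map $\theta$ from a subset $W$ of a group to a group is a *local homomorphism* if $\theta(xy)=\theta(x)\theta(y)$ whenever $x,y,xy\in W$. Write $\prod_4 X=X\cdot X\cdot X\cdot X$, and $\langle X\rangle$ for the subgroup generated by $X$. Let $\mathcal{Z}$ and $\mathcal{V}$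 be locally definable groups such that $\mathcal{Z}^{00}$ exists. Let $W\subseteq\mathcal{Z}$ be a definable set with $\mathcal{Z}^{00}\subseteq W$, and let $\theta:W\to\mathcal{V}$ be a definable local homomorphism. Then there is a definable set $W'\subseteq W$ that is symmetric ($W'^{-1}=W'$) such that: (i) $\mathcal{Z}^{00}\subseteq W'\subseteq\prod_4 W'\subseteq W$, and $\theta(W')$ is (definable and) generic in $\langle\theta(W')\rangle$; (ii) $\theta(\mathcal{Z}^{00})$ is a type-definable subgroup of $\langle\theta(W')\rangle$ of index less than $\kappa$; moreover $\langle\theta(W')\rangle^{00}$ exists, and $\langle\theta(W')\rangle^{00}\subseteq\theta(\mathcal{Z}^{00})\subseteq\theta(W')$. -/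

import Mathlib

open Cardinal
open scoped Pointwise

universe u v w

/-- A finite union of points and open intervals (with endpoints in `R ∪ {-∞, +∞}`). -/
def IsFiniteUnionOfPointsAndIntervals {R : Type w} [LinearOrder R] (s : Set R) : Prop :=
  ∃ F : Set (Set R), F.Finite ∧ s = ⋃₀ F ∧
    ∀ t ∈ F, (∃ a, t = {a}) ∨ (∃ a b, t = Set.Ioo a b) ∨ (∃ a, t = Set.Ioi a) ∨
      (∃ b, t = Set.Iio b) ∨ t = Set.univ

/-- The `L`-structure on `R` is an o-minimal expansion of the ordered field `R`: the order,
the addition and the multiplication are `∅`-definable, and every subset of `R` definable with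
parameters is a finite union of points and open intervals. -/
structure IsOMinimalExpansion (L : FirstOrder.Language.{u, v}) (R : Type w) [Field R] [LinearOrder R]
    [L.Structure R] : Prop where
  lt_definable : (∅ : Set R).Definable L {x : Fin 2 → R | x 0 < x 1}
  add_definable : (∅ : Set R).Definable L {x : Fin 3 → R | x 0 + x 1 = x 2}
  mul_definable : (∅ : Set R).Definable L {x : Fin 3 → R | x 0 * x 1 = x 2}
  o_minimal : ∀ s : Set R, (Set.univ : Set R).Definable₁ L s → IsFiniteUnionOfPointsAndIntervals s

/-- `R` is `κ`-saturated: for every parameter set `A` with `|A| < κ`, every (partial) `n`-type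
over `A` that is finitely satisfiable in `R` is realized in `R`.
Types are given by the `A`-definable sets defined by their formulas. -/
def IsSaturated (L : FirstOrder.Language.{u, v}) (R : Type w) [L.Structure R] (κ : Cardinal.{w}) : Prop :=
  ∀ A : Set R, #A < κ → ∀ (n : ℕ) (S : Set (Set (Fin n → R))),
    (∀ s ∈ S, A.Definable L s) →
    (∀ T : Set (Set (Fin n → R)), T ⊆ S → T.Finite → (⋂₀ T).Nonempty) →
    (⋂₀ S).Nonempty

section

variable (L : FirstOrder.Language.{u, v}) {R : Type w} [L.Structure R] (κ : Cardinal.{w}) {m n : ℕ}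

/-- A group whose underlying set `U ⊆ R ^ n` is the union of a countable directed family of
definable sets, such that the restriction of the multiplication to the product of any two members
of the family is a definable map. -/
def IsLocallyDefinableGroup (U : Set (Fin n → R)) [Group U] : Prop :=
  ∃ X : ℕ → Set (Fin n → R),
    (∀ i, (Set.univ : Set R).Definable L (X i)) ∧
    Directed (· ⊆ ·) X ∧
    (⋃ i, X i) = U ∧
    ∀ i j, (Set.univ : Set R).Definable L
      {p : Fin n ⊕ Fin n ⊕ Fin n → R | ∃ a b : U, a.1 ∈ X i ∧ b.1 ∈ X j ∧
        p = Sum.elim a.1 (Sum.elim b.1 (a * b).1)}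

/-- A subset of `U ⊆ R ^ n` is definable (with parameters) as a subset of `R ^ n`. -/
def IsDefinableIn {U : Set (Fin n → R)} (X : Set U) : Prop :=
  (Set.univ : Set R).Definable L (Subtype.val '' X)

/-- A subset of `U ⊆ R ^ n` is type-definable: it is the set of realizations of a partial type
over a parameter set of cardinality less than `κ`. -/
def IsTypeDefinableIn {U : Set (Fin n → R)} (X : Set U) : Prop :=
  ∃ A : Set R, #A < κ ∧ ∃ S : Set (Set (Fin n → R)),
    (∀ s ∈ S, A.Definable L s) ∧ Subtype.val '' X = ⋂₀ S

/-- A map from a subset `W` of `U ⊆ R ^ m` to `V ⊆ R ^ n` is definable: its graph is. -/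
def IsDefinableMap {U : Set (Fin m → R)} {V : Set (Fin n → R)} {W : Set U} (f : W → V) : Prop :=
  (Set.univ : Set R).Definable L
    {p : Fin m ⊕ Fin n → R | ∃ x : W, p = Sum.elim x.1.1 (f x).1}

/-- For a subgroup `G` of the group `U ⊆ R ^ n`: `K` is a type-definable subgroup of `G` of index
less than `κ`. -/
def IsTypeDefinableBoundedIndex {U : Set (Fin n → R)} [Group U] (G K : Subgroup U) : Prop :=
  K ≤ G ∧ IsTypeDefinableIn L κ (K : Set U) ∧ #(G ⧸ K.subgroupOf G) < κ

/-- `K` is `G⁰⁰`, the smallest type-definable subgroup of `G` of index less than `κ`;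
`∃ K, IsZeroZero L κ G K` says that `G⁰⁰` exists. -/
def IsZeroZero {U : Set (Fin n → R)} [Group U] (G K : Subgroup U) : Prop :=
  IsTypeDefinableBoundedIndex L κ G K ∧
    ∀ K' : Subgroup U, IsTypeDefinableBoundedIndex L κ G K' → K ≤ K'

/-- `X` is a generic subset of the subgroup `G` of `U ⊆ R ^ n`: a definable subset of `G` such that
fewer than `κ` left translates, and also fewer than `κ` right translates, of `X` by elements of `G`
cover `G`. -/
def IsGenericIn {U : Set (Fin n → R)} [Group U] (G : Subgroup U) (X : Set U) : Prop :=
  IsDefinableIn L X ∧ X ⊆ G ∧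
    (∃ A : Set U, A ⊆ G ∧ #A < κ ∧ A * X = G) ∧
    (∃ A : Set U, A ⊆ G ∧ #A < κ ∧ X * A = G)

end

/-- A map `f` on a subset `W` of a group is a local homomorphism: `f (x y) = f x f y` whenever
`x`, `y` and `x y` lie in `W`. -/
def IsLocalGroupHom {G H : Type*} [Group G] [Group H] {W : Set G} (f : W → H) : Prop :=
  ∀ (x y : W) (hxy : (x : G) * y ∈ W), f ⟨(x : G) * y, hxy⟩ = f x * f y

/-- The image `f (X ∩ W)` of a set `X` under a map `f` defined on `W`. -/
def imageOn {G H : Type*} {W : Set G} (f : W → H) (X : Set G) : Set H :=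
  f '' {x : W | (x : G) ∈ X}

/-! Since `Z00` is type-definable, compactness applied twice, followed by intersection with the
inverse, gives a symmetric definable `Y` containing `Z00` with fourfold product in `W`. Put `X =
θ(Y)` and `H = θ(Z00)`, a subgroup inside `X`. The set `Y * Y` meets fewer than `κ` cosets of `Z00`,
and `θ` is multiplicative on each of them, so `X * X ⊆ B * H` for a small `B ⊆ ⟨X⟩`
(`exists_imageOn_mul_subset`). Then `H * X ⊆ B * H`, so `⟨B⟩ * H` is stable under right
multiplication by `X` and contains `⟨X⟩` (`coe_closure_subset_closure_mul`). As `⟨B⟩` is small, `H`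
has small index and `X` is generic. In fact `H` is itself `⟨X⟩⁰⁰`: if `K'` is type-definable of
small index in `⟨X⟩`, its preimage in `Z00` is type-definable of small index in `Z`, hence is all of
`Z00` by minimality, so `H ≤ K'`. -/

/-! ### Counting cosets and generated subgroups -/

section Quotient

variable {G : Type w} [Group G]

/-- A map that separates the left cosets of `N` bounds the number of these cosets. -/
theorem mk_quotient_le_of_separates {α : Type w} (N : Subgroup G) (f : G → α)
    (hf : ∀ x y, f x = f y → x⁻¹ * y ∈ N) : #(G ⧸ N) ≤ #α := by
  refine Cardinal.mk_le_of_injective (f := fun q : G ⧸ N => f q.out) fun p q h => ?_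
  rw [← p.out_eq', ← q.out_eq']
  exact QuotientGroup.eq.2 (hf _ _ h)

theorem mk_subgroupClosure_lt {κ : Cardinal.{w}} (hκ : ℵ₀ < κ) {B : Set G} (hB : #B < κ) :
    #(Subgroup.closure B) < κ := by
  rw [FreeGroup.closure_eq_range]
  refine (Cardinal.mk_range_le (f := FreeGroup.lift ((↑) : B → G))).trans_lt ?_
  rcases isEmpty_or_nonempty B with h | h
  · exact (Cardinal.mk_le_aleph0).trans_lt hκ
  · rw [Cardinal.mk_freeGroup]
    exact max_lt hB hκ

/-- If `X` is symmetric and `X * X` is covered by the translates of a subgroup `H ⊆ X` by elements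
of `B`, then `⟨X⟩` is covered by the translates of `H` by elements of `⟨B⟩`. -/
theorem coe_closure_subset_closure_mul {X B : Set G} {H : Subgroup G} (hX : X⁻¹ = X)
    (hH : (H : Set G) ⊆ X) (hB : X * X ⊆ B * H) :
    (Subgroup.closure X : Set G) ⊆ (Subgroup.closure B : Set G) * (H : Set G) := by
  have key : ∀ y ∈ X, ∀ x ∈ (Subgroup.closure B : Set G) * (H : Set G),
      x * y ∈ (Subgroup.closure B : Set G) * (H : Set G) := by
    rintro y hy _ ⟨c, hc, h, hh, rfl⟩
    -- `h * y` lies in `X * X`, so the factor from `H` moves to the right past `y` at the cost of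
    -- one element of `B`.
    obtain ⟨b, hb, k, hk, hbk⟩ := hB (Set.mul_mem_mul (hH hh) hy)
    refine ⟨c * b, mul_mem hc (Subgroup.subset_closure hb), k, hk, ?_⟩
    simp only at hbk ⊢
    rw [mul_assoc, hbk, mul_assoc]
  intro x hx
  induction hx using Subgroup.closure_induction_right with
  | one => exact ⟨1, one_mem _, 1, one_mem _, mul_one _⟩
  | mul_right x _ y hy ih => exact key y hy x ih
  | mul_inv_cancel x _ y hy ih => exact key y⁻¹ (by rw [← hX]; simpa using hy) x ih

end Quotient

/-! ### Saturation and compactness -/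

section Definability

variable {L : FirstOrder.Language.{u, v}} {R : Type w} [L.Structure R] {κ : Cardinal.{w}}

/-- Each set needs only finitely many parameters; a countable parameter set is small enough for
saturation. -/
theorem exists_countable_definable {ι α : Type*} [Countable ι] {s : ι → Set (α → R)}
    (hs : ∀ i, (Set.univ : Set R).Definable L (s i)) :
    ∃ A : Set R, A.Countable ∧ ∀ i, A.Definable L (s i) := by
  choose A _ hA using fun i => Set.definable_iff_finitely_definable.1 (hs i)
  exact ⟨⋃ i, (A i : Set R), Set.countable_iUnion fun i => (A i).countable_toSet,
    fun i => (hA i).mono (Set.subset_iUnion (fun i => (A i : Set R)) i)⟩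

theorem mk_union_lt (hκ : ℵ₀ < κ) {A B : Set R} (hA : #A < κ) (hB : B.Countable) :
    #(A ∪ B : Set R) < κ :=
  (Cardinal.mk_union_le A B).trans_lt
    (Cardinal.add_lt_of_lt hκ.le hA (hB.le_aleph0.trans_lt hκ))

theorem definable_fiber {α β : Type*} [Finite α] [Finite β] {Γ : Set (α ⊕ β → R)}
    (hΓ : (Set.univ : Set R).Definable L Γ) (y : β → R) :
    (Set.univ : Set R).Definable L {x : α → R | Sum.elim x y ∈ Γ} := by
  refine Set.Definable.preimage_map (F := fun x : α → R => Sum.elim x y) ?_ hΓ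
  rintro (i | j)
  · exact Set.DefinableFun.proj L
  · exact L.definableFun_const α (Set.mem_univ (y j))

/-- The image of a definable set under a definable relation is definable. -/
theorem definable_relImage {α β : Type*} [Finite α] [Finite β] {A : Set R} {Γ : Set (α ⊕ β → R)}
    (hΓ : A.Definable L Γ) {s : Set (α → R)} (hs : A.Definable L s) :
    A.Definable L {y : β → R | ∃ x ∈ s, Sum.elim x y ∈ Γ} := by
  convert! (hΓ.inter (hs.preimage_comp Sum.inl)).image_comp (Sum.inr : β → α ⊕ β) using 1
  ext y
  constructor
  · rintro ⟨x, hx, h⟩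
    exact ⟨Sum.elim x y, ⟨h, by simpa using hx⟩, by simp⟩
  · rintro ⟨p, ⟨hp, hps⟩, rfl⟩
    exact ⟨p ∘ Sum.inl, hps, by simpa using hp⟩

/-- The preimage of a definable set under a definable relation is definable. -/
theorem definable_relPreimage {α β : Type*} [Finite α] [Finite β] {A : Set R}
    {Γ : Set (α ⊕ β → R)} (hΓ : A.Definable L Γ) {s : Set (β → R)} (hs : A.Definable L s) :
    A.Definable L {x : α → R | ∃ y ∈ s, Sum.elim x y ∈ Γ} := by
  convert! (hΓ.inter (hs.preimage_comp Sum.inr)).image_comp (Sum.inl : α → α ⊕ β) using 1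
  ext x
  constructor
  · rintro ⟨y, hy, h⟩
    exact ⟨Sum.elim x y, ⟨h, by simpa using hy⟩, by simp⟩
  · rintro ⟨p, ⟨hp, hps⟩, rfl⟩
    exact ⟨p ∘ Sum.inr, hps, by simpa using hp⟩

theorem IsSaturated.nonempty_iInter (hsat : IsSaturated L R κ) {A : Set R} (hA : #A < κ)
    {α : Type} [Finite α] {ι : Type*} {s : ι → Set (α → R)} (hs : ∀ i, A.Definable L (s i))
    (hfin : ∀ F : Finset ι, (⋂ i ∈ F, s i).Nonempty) : (⋂ i, s i).Nonempty := by
  classical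
  obtain ⟨n, ⟨e⟩⟩ := Finite.exists_equiv_fin α
  obtain ⟨x, hx⟩ := hsat A hA n
    (Set.range fun i => (fun g : Fin n → R => g ∘ e) ⁻¹' s i)
    (by rintro _ ⟨i, rfl⟩; exact (hs i).preimage_comp e)
    (by
      intro T hT hTfin
      lift T to Finset (Set (Fin n → R)) using hTfin
      rw [← Set.image_univ, Finset.subset_set_image_iff] at hT
      obtain ⟨F, -, rfl⟩ := hT
      obtain ⟨x, hx⟩ := hfin F
      refine ⟨x ∘ e.symm, ?_⟩
      intro t ht
      obtain ⟨i, hi, rfl⟩ := Finset.mem_image.1 ht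
      simpa [Function.comp_assoc] using Set.mem_iInter₂.1 hx i hi)
  exact ⟨x ∘ e, Set.mem_iInter.2 fun i => hx _ ⟨i, rfl⟩⟩

/-- Compactness: a definable set containing a small intersection contains a finite one. -/
theorem IsSaturated.exists_finset_biInter_subset (hsat : IsSaturated L R κ) (hκ : ℵ₀ < κ)
    {A : Set R} (hA : #A < κ) {α : Type} [Finite α] {ι : Type*} {s : ι → Set (α → R)}
    (hs : ∀ i, A.Definable L (s i)) {t : Set (α → R)} (ht : (Set.univ : Set R).Definable L t)
    (hst : ⋂ i, s i ⊆ t) : ∃ F : Finset ι, ⋂ i ∈ F, s i ⊆ t := by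
  classical
  by_contra! hne
  obtain ⟨B, -, hB⟩ := Set.definable_iff_finitely_definable.1 ht
  obtain ⟨x, hx⟩ := hsat.nonempty_iInter (mk_union_lt hκ hA B.countable_toSet)
    (s := fun i : ι => s i \ t)
    (fun i => ((hs i).mono Set.subset_union_left).sdiff (hB.mono Set.subset_union_right))
    (fun F => by
      obtain ⟨x, hx, hxt⟩ := Set.not_subset.1 (hne F)
      exact ⟨x, Set.mem_iInter₂.2 fun i hi => ⟨Set.mem_iInter₂.1 hx i hi, hxt⟩⟩)
  -- Over an empty index type the sets `s i \ t` say nothing about `t`, so `F = ∅` is used directly.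
  rcases isEmpty_or_nonempty ι with h | ⟨⟨i⟩⟩
  · exact hne ∅ (by simpa using hst)
  · exact (Set.mem_iInter.1 hx i).2 (hst (Set.mem_iInter.2 fun j => (Set.mem_iInter.1 hx j).1))

/-- In a saturated structure the image of a small intersection of definable sets under a definable
relation is the intersection of the images of the finite intersections. -/
theorem IsSaturated.relImage_iInter (hsat : IsSaturated L R κ) (hκ : ℵ₀ < κ) {A : Set R}
    (hA : #A < κ) {α β : Type} [Finite α] [Finite β] {Γ : Set (α ⊕ β → R)}
    (hΓ : (Set.univ : Set R).Definable L Γ) {ι : Type*} {s : ι → Set (α → R)}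
    (hs : ∀ i, A.Definable L (s i)) :
    {y : β → R | ∃ x ∈ ⋂ i, s i, Sum.elim x y ∈ Γ} =
      ⋂ F : Finset ι, {y : β → R | ∃ x ∈ ⋂ i ∈ F, s i, Sum.elim x y ∈ Γ} := by
  refine Set.Subset.antisymm ?_ fun y h => ?_
  · rintro y ⟨x, hx, hxy⟩
    refine Set.mem_iInter.2 fun F => ⟨x, Set.mem_iInter₂.2 fun i _ => Set.mem_iInter.1 hx i, hxy⟩
  · by_contra hne
    -- If no point of the intersection is related to `y`, the intersection lies in the complement of
    -- the fibre over `y`.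
    obtain ⟨F, hF⟩ := hsat.exists_finset_biInter_subset hκ hA hs (definable_fiber hΓ y).compl
      (fun x hx hxy => hne ⟨x, hx, hxy⟩)
    obtain ⟨x, hx, hxy⟩ := Set.mem_iInter.1 h F
    exact hF hx hxy

end Definability

/-! ### Compactness in locally definable groups -/

section LocallyDefinable

variable {L : FirstOrder.Language.{u, v}} {R : Type w} [L.Structure R] {κ : Cardinal.{w}} {n : ℕ}

theorem definable_singleton_tuple (y : Fin n → R) :
    (Set.univ : Set R).Definable L ({y} : Set (Fin n → R)) := by
  have h : ({y} : Set (Fin n → R)) = ⋂ i, {x | x i = y i} := by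
    ext x
    simp [funext_iff]
  rw [h]
  exact Set.definable_iInter_of_finite fun i =>
    (Set.DefinableFun.proj L).ofPred_eq_const (Set.mem_univ _)

variable {U : Set (Fin n → R)} [Group U]

/-- A definable subset of a countable directed union of definable sets lies in one of them. -/
theorem IsSaturated.exists_subset_of_subset_iUnion (hsat : IsSaturated L R κ) (hκ : ℵ₀ < κ)
    {X : ℕ → Set (Fin n → R)} (hX : ∀ i, (Set.univ : Set R).Definable L (X i))
    (hdir : Directed (· ⊆ ·) X) {Y : Set (Fin n → R)} (hY : (Set.univ : Set R).Definable L Y)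
    (hYX : Y ⊆ ⋃ i, X i) : ∃ i, Y ⊆ X i := by
  obtain ⟨A, hA, hAX⟩ := exists_countable_definable hX
  obtain ⟨F, hF⟩ := hsat.exists_finset_biInter_subset hκ (hA.le_aleph0.trans_lt hκ)
    (fun i => (hAX i).compl) hY.compl (by
      rw [← Set.compl_iUnion]
      exact Set.compl_subset_compl.2 hYX)
  obtain ⟨j, hj⟩ := hdir.finset_le F
  refine ⟨j, fun y hy => ?_⟩
  by_contra hyj
  exact hF (Set.mem_iInter₂.2 fun i hi h => hyj (hj i hi h)) hy

/-- The set of pairs from a definable set whose product lies in another definable set. -/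
theorem IsLocallyDefinableGroup.definable_mul_mem (hU : IsLocallyDefinableGroup L U)
    (hsat : IsSaturated L R κ) (hκ : ℵ₀ < κ) {Y T : Set U} (hY : IsDefinableIn L Y)
    (hT : IsDefinableIn L T) :
    (Set.univ : Set R).Definable L {p : Fin n ⊕ Fin n → R | ∃ a b : U, a ∈ Y ∧ b ∈ Y ∧
      a * b ∈ T ∧ p = Sum.elim a.1 b.1} := by
  obtain ⟨X, hX, hdir, hXU, hmul⟩ := hU
  -- Multiplication is definable only piecewise; a definable `Y` fits into a single piece.
  obtain ⟨i, hi⟩ := hsat.exists_subset_of_subset_iUnion hκ hX hdir hY (by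
    rw [hXU]
    rintro _ ⟨a, -, rfl⟩
    exact a.2)
  convert! (((hmul i i).inter (hY.preimage_comp Sum.inl)).inter
    ((hY.preimage_comp (Sum.inr ∘ Sum.inl)).inter
      (hT.preimage_comp (Sum.inr ∘ Sum.inr)))).image_comp
        (Sum.elim Sum.inl (Sum.inr ∘ Sum.inl) : Fin n ⊕ Fin n → Fin n ⊕ Fin n ⊕ Fin n) using 1
  ext p
  constructor
  · rintro ⟨a, b, ha, hb, hab, rfl⟩
    refine ⟨Sum.elim a.1 (Sum.elim b.1 (a * b).1),
      ⟨⟨⟨a, b, hi ⟨a, ha, rfl⟩, hi ⟨b, hb, rfl⟩, rfl⟩, ⟨a, ha, rfl⟩⟩,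
        ⟨b, hb, rfl⟩, ⟨a * b, hab, rfl⟩⟩, ?_⟩
    ext (j | j) <;> rfl
  · rintro ⟨_, ⟨⟨⟨a, b, -, -, rfl⟩, a', ha, haa⟩, ⟨b', hb, hbb⟩, ⟨c, hc, hcc⟩⟩, rfl⟩
    obtain rfl : a' = a := Subtype.ext haa
    obtain rfl : b' = b := Subtype.ext hbb
    obtain rfl : c = a' * b' := Subtype.ext hcc
    refine ⟨a', b', ha, hb, hc, ?_⟩
    ext (j | j) <;> rfl

/-- Inversion is not assumed definable, but `Y ∩ Y⁻¹` is the projection of the pairs in `Y` with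
product `1`. -/
theorem IsLocallyDefinableGroup.isDefinableIn_inter_inv (hU : IsLocallyDefinableGroup L U)
    (hsat : IsSaturated L R κ) (hκ : ℵ₀ < κ) {Y : Set U} (hY : IsDefinableIn L Y) :
    IsDefinableIn L (Y ∩ Y⁻¹) := by
  have h1 : IsDefinableIn L ({1} : Set U) := by
    rw [IsDefinableIn, Set.image_singleton]
    exact definable_singleton_tuple _
  unfold IsDefinableIn
  convert! (hU.definable_mul_mem hsat hκ hY h1).image_comp (Sum.inl : Fin n → Fin n ⊕ Fin n) using 1
  ext x
  constructor
  · rintro ⟨a, ⟨ha, ha'⟩, rfl⟩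
    exact ⟨_, ⟨a, a⁻¹, ha, ha', by simp, rfl⟩, rfl⟩
  · rintro ⟨_, ⟨a, b, ha, hb, hab, rfl⟩, rfl⟩
    refine ⟨a, ⟨ha, ?_⟩, rfl⟩
    rwa [Set.mem_inv, inv_eq_of_mul_eq_one_right hab]

/-- A definable set containing a type-definable subgroup `K` contains the square of a definable set
containing `K`. -/
theorem IsLocallyDefinableGroup.exists_mul_self_subset (hU : IsLocallyDefinableGroup L U)
    (hsat : IsSaturated L R κ) (hκ : ℵ₀ < κ) {K : Subgroup U}
    (hK : IsTypeDefinableIn L κ (K : Set U)) {Y : Set U} (hY : IsDefinableIn L Y)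
    (hKY : (K : Set U) ⊆ Y) :
    ∃ Y' : Set U, IsDefinableIn L Y' ∧ (K : Set U) ⊆ Y' ∧ Y' ⊆ Y ∧ Y' * Y' ⊆ Y := by
  obtain ⟨A, hA, S, hS, hKS⟩ := hK
  -- Compactness for pairs: `K × K` is a small intersection inside the definable set of pairs with
  -- product in `Y`.
  obtain ⟨F, hF⟩ := hsat.exists_finset_biInter_subset hκ hA
    (s := fun s : S => {p : Fin n ⊕ Fin n → R | p ∘ Sum.inl ∈ s.1} ∩ {p | p ∘ Sum.inr ∈ s.1})
    (fun s => ((hS s s.2).preimage_comp _).inter ((hS s s.2).preimage_comp _))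
    (hU.definable_mul_mem hsat hκ hY hY) (by
      intro p hp
      rw [Set.mem_iInter] at hp
      have hl : p ∘ Sum.inl ∈ ⋂₀ S := fun s hs => (hp ⟨s, hs⟩).1
      have hr : p ∘ Sum.inr ∈ ⋂₀ S := fun s hs => (hp ⟨s, hs⟩).2
      rw [← hKS] at hl hr
      obtain ⟨a, ha, hal⟩ := hl
      obtain ⟨b, hb, hbr⟩ := hr
      exact ⟨a, b, hKY ha, hKY hb, hKY (mul_mem ha hb), by rw [hal, hbr, Sum.elim_comp_inl_inr]⟩)
  refine ⟨{x | x ∈ Y ∧ ∀ s ∈ F, x.1 ∈ s.1}, ?_, fun x hx => ⟨hKY hx, fun s _ => ?_⟩,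
    fun x hx => hx.1, ?_⟩
  · unfold IsDefinableIn
    convert! hY.inter ((Set.definable_biInter_finset (fun s : S => hS s s.2) F).mono
      (Set.subset_univ A)) using 1
    ext x
    simp
  · have : x.1 ∈ ⋂₀ S := hKS ▸ ⟨x, hx, rfl⟩
    exact this s s.2
  · rintro _ ⟨a, ha, b, hb, rfl⟩
    obtain ⟨a', b', -, -, h, hab⟩ := hF (a := Sum.elim a.1 b.1)
      (Set.mem_iInter₂.2 fun s hs => ⟨ha.2 s hs, hb.2 s hs⟩)
    obtain rfl : a = a' := Subtype.ext (funext fun j => congrFun hab (Sum.inl j))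
    obtain rfl : b = b' := Subtype.ext (funext fun j => congrFun hab (Sum.inr j))
    exact h

end LocallyDefinable

/-! ### Local homomorphisms -/

section LocalHom

variable {G H : Type*} [Group G] [Group H] {W : Set G} {f : W → H}

/-- A local homomorphism restricts to a homomorphism on each subgroup contained in its domain. -/
def IsLocalGroupHom.restrict (hf : IsLocalGroupHom f) {K : Subgroup G} (hK : (K : Set G) ⊆ W) :
    K →* H :=
  MonoidHom.mk' (fun x => f ⟨x, hK x.2⟩) fun x y =>
    hf ⟨x, hK x.2⟩ ⟨y, hK y.2⟩ (hK (mul_mem x.2 y.2))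

theorem IsLocalGroupHom.coe_range_restrict (hf : IsLocalGroupHom f) {K : Subgroup G}
    (hK : (K : Set G) ⊆ W) : ((hf.restrict hK).range : Set H) = imageOn f (K : Set G) := by
  ext y
  constructor
  · rintro ⟨x, rfl⟩
    exact ⟨⟨x, hK x.2⟩, x.2, rfl⟩
  · rintro ⟨x, hx, rfl⟩
    exact ⟨⟨x, hx⟩, rfl⟩

theorem IsLocalGroupHom.map_one (hf : IsLocalGroupHom f) (h1 : (1 : G) ∈ W) : f ⟨1, h1⟩ = 1 := by
  have h := hf ⟨1, h1⟩ ⟨1, h1⟩ (by simpa using h1)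
  simpa using h

theorem IsLocalGroupHom.map_inv (hf : IsLocalGroupHom f) (h1 : (1 : G) ∈ W) (x : W)
    (hx : (x : G)⁻¹ ∈ W) : f ⟨(x : G)⁻¹, hx⟩ = (f x)⁻¹ := by
  have h := hf x ⟨(x : G)⁻¹, hx⟩ (by simpa using h1)
  simp only [mul_inv_cancel, hf.map_one h1] at h
  exact (inv_eq_of_mul_eq_one_right h.symm).symm

theorem IsLocalGroupHom.imageOn_inv (hf : IsLocalGroupHom f) (h1 : (1 : G) ∈ W) {X : Set G}
    (hXW : X ⊆ W) (hX : X⁻¹ = X) : (imageOn f X)⁻¹ = imageOn f X := by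
  have key : ∀ y ∈ imageOn f X, y⁻¹ ∈ imageOn f X := by
    rintro _ ⟨x, hx, rfl⟩
    have hx' : (x : G)⁻¹ ∈ X := by
      rw [← hX]
      simpa using hx
    exact ⟨⟨_, hXW hx'⟩, hx', hf.map_inv h1 x _⟩
  ext y
  exact ⟨fun hy => by simpa using key _ hy, key y⟩

end LocalHom

theorem imageOn_mono {G H : Type*} {W : Set G} {f : W → H} {X Y : Set G} (h : X ⊆ Y) :
    imageOn f X ⊆ imageOn f Y :=
  Set.image_mono fun _ hx => h hx

/-! ### Small index transferred along a local homomorphism -/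

section LocalHomCover

variable {G H : Type w} [Group G] [Group H] {W : Set G} {f : W → H}

/-- The product of the image of `X` with itself is covered by few translates of the image of a
subgroup of small index. -/
theorem IsLocalGroupHom.exists_imageOn_mul_subset (hf : IsLocalGroupHom f) {K : Subgroup G}
    (hK : (K : Set G) ⊆ W) {X : Set G} (hXW : X ⊆ W) (hXX : X * X ⊆ W) (h1 : (1 : G) ∈ X) :
    ∃ B : Set H, B ⊆ Subgroup.closure (imageOn f X) ∧ #B ≤ #(G ⧸ K) ∧
      imageOn f X * imageOn f X ⊆ B * ((hf.restrict hK).range : Set H) := by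
  classical
  -- Representatives are taken in `X * X`, where `f` is defined and has values in `⟨f(X)⟩`; cosets
  -- missing `X * X` get the default `1 * 1`.
  have hr : ∀ q : G ⧸ K, ∃ r ∈ X * X,
      (∃ x ∈ X * X, (QuotientGroup.mk x : G ⧸ K) = q) → (QuotientGroup.mk r : G ⧸ K) = q := by
    intro q
    by_cases h : ∃ x ∈ X * X, (QuotientGroup.mk x : G ⧸ K) = q
    · obtain ⟨x, hx, hxq⟩ := h
      exact ⟨x, hx, fun _ => hxq⟩
    · exact ⟨1 * 1, Set.mul_mem_mul h1 h1, fun h' => absurd h' h⟩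
  choose r hrX hrq using hr
  refine ⟨Set.range fun q => f ⟨r q, hXX (hrX q)⟩, ?_, Cardinal.mk_range_le, ?_⟩
  · rintro _ ⟨q, rfl⟩
    obtain ⟨a, ha, b, hb, hab⟩ := hrX q
    have hmul := hf ⟨a, hXW ha⟩ ⟨b, hXW hb⟩ (hXX (Set.mul_mem_mul ha hb))
    simp only at hab hmul
    simp only [← hab, hmul]
    exact mul_mem (Subgroup.subset_closure ⟨_, ha, rfl⟩) (Subgroup.subset_closure ⟨_, hb, rfl⟩)
  · rintro _ ⟨_, ⟨a, ha, rfl⟩, _, ⟨b, hb, rfl⟩, rfl⟩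
    have hab : (a : G) * b ∈ X * X := Set.mul_mem_mul ha hb
    set q : G ⧸ K := QuotientGroup.mk ((a : G) * b)
    have hk : (r q)⁻¹ * ((a : G) * b) ∈ K := QuotientGroup.eq.1 (hrq q ⟨_, hab, rfl⟩)
    refine ⟨_, ⟨q, rfl⟩, _, ⟨⟨_, hk⟩, rfl⟩, ?_⟩
    have h := hf ⟨r q, hXX (hrX q)⟩ ⟨_, hK hk⟩ (by simpa using hXX hab)
    have h' := hf a b (hXX hab)
    simp only [mul_inv_cancel_left] at h
    exact h.symm.trans h'

/-- If a subgroup `K` of the domain of a local homomorphism has small index and `P` is a subgroup of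
small index of a group containing the image of `K`, then the preimage of `P` in `K` has small
index. -/
theorem IsLocalGroupHom.mk_quotient_comap_lt (hf : IsLocalGroupHom f) {K : Subgroup G}
    (hK : (K : Set G) ⊆ W) {κ : Cardinal.{w}} (hκ : ℵ₀ ≤ κ) (hKκ : #(G ⧸ K) < κ)
    {Q P : Subgroup H} (hQ : (hf.restrict hK).range ≤ Q) (hP : #(Q ⧸ P.subgroupOf Q) < κ) :
    #(G ⧸ (P.comap (hf.restrict hK)).map K.subtype) < κ := by
  have hout : ∀ x : G, (QuotientGroup.mk x : G ⧸ K).out⁻¹ * x ∈ K := fun x =>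
    QuotientGroup.eq.1 (QuotientGroup.out_eq' _)
  let φ : K → Q := fun x => ⟨hf.restrict hK x, hQ ⟨x, rfl⟩⟩
  -- A point `x` is recorded by its coset of `K` and by the class modulo `P` of the image of its
  -- `K`-part.
  refine (mk_quotient_le_of_separates (α := (G ⧸ K) × (Q ⧸ P.subgroupOf Q)) _
    (fun x => (QuotientGroup.mk x, QuotientGroup.mk (φ ⟨_, hout x⟩))) ?_).trans_lt ?_
  · intro x y hxy
    obtain ⟨h₁, h₂⟩ := Prod.ext_iff.1 hxy
    have h₃ := QuotientGroup.eq.1 h₂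
    rw [Subgroup.mem_subgroupOf] at h₃
    refine ⟨⟨_, hout x⟩⁻¹ * ⟨_, hout y⟩, ?_, ?_⟩
    · simpa [φ] using h₃
    · simp only at h₁
      simp [h₁, mul_assoc]
  · rw [Cardinal.mk_prod, Cardinal.lift_id, Cardinal.lift_id]
    exact Cardinal.mul_lt_of_lt hκ hKκ hP

end LocalHomCover

/-! ### Images and preimages of type-definable sets -/

section DefinableMap

variable {L : FirstOrder.Language.{u, v}} {R : Type w} [L.Structure R] {κ : Cardinal.{w}} {m n : ℕ}
  {U : Set (Fin m → R)} {V : Set (Fin n → R)} {W : Set U} {f : W → V}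

theorem val_image_imageOn (f : W → V) (X : Set U) :
    Subtype.val '' imageOn f X = {y : Fin n → R | ∃ x ∈ (Subtype.val '' X : Set (Fin m → R)),
      Sum.elim x y ∈ {p : Fin m ⊕ Fin n → R | ∃ x : W, p = Sum.elim x.1.1 (f x).1}} := by
  ext y
  constructor
  · rintro ⟨_, ⟨x, hx, rfl⟩, rfl⟩
    exact ⟨x.1.1, ⟨x.1, hx, rfl⟩, x, rfl⟩
  · rintro ⟨_, ⟨x, hx, rfl⟩, x', h⟩
    obtain rfl : x = x'.1 := Subtype.ext (funext fun j => congrFun h (Sum.inl j))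
    obtain rfl : y = (f x').1 := funext fun j => congrFun h (Sum.inr j)
    exact ⟨_, ⟨x', hx, rfl⟩, rfl⟩

theorem IsDefinableMap.isDefinableIn_imageOn (hf : IsDefinableMap L f) {X : Set U}
    (hX : IsDefinableIn L X) : IsDefinableIn L (imageOn f X) := by
  rw [IsDefinableIn, val_image_imageOn]
  exact definable_relImage hf hX

theorem IsDefinableMap.isTypeDefinableIn_imageOn (hf : IsDefinableMap L f)
    (hsat : IsSaturated L R κ) (hκ : ℵ₀ < κ) {X : Set U} (hX : IsTypeDefinableIn L κ X) :
    IsTypeDefinableIn L κ (imageOn f X) := by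
  obtain ⟨A, hA, S, hS, hXS⟩ := hX
  obtain ⟨B, -, hB⟩ := Set.definable_iff_finitely_definable.1 hf
  have hS' : ∀ s : S, (A ∪ B).Definable L s.1 := fun s => (hS s s.2).mono Set.subset_union_left
  -- Images do not commute with intersections in general, so the type consists of the images of all
  -- finite intersections.
  refine ⟨A ∪ B, mk_union_lt hκ hA B.countable_toSet,
    Set.range fun F : Finset S => {y : Fin n → R | ∃ x ∈ ⋂ s ∈ F, s.1,
      Sum.elim x y ∈ {p : Fin m ⊕ Fin n → R | ∃ x : W, p = Sum.elim x.1.1 (f x).1}}, ?_, ?_⟩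
  · rintro _ ⟨F, rfl⟩
    exact definable_relImage (hB.mono Set.subset_union_right) (Set.definable_biInter_finset hS' F)
  · rw [val_image_imageOn, hXS, Set.sInter_eq_iInter, Set.sInter_range]
    exact hsat.relImage_iInter hκ hA hf fun s => hS s s.2

/-- The set of points of a type-definable set mapped into a type-definable set by a definable map
is type-definable. -/
theorem IsDefinableMap.isTypeDefinableIn_preimage (hf : IsDefinableMap L f) (hκ : ℵ₀ < κ)
    {X : Set U} (hX : IsTypeDefinableIn L κ X) (hXW : X ⊆ W) {Y : Set V}
    (hY : IsTypeDefinableIn L κ Y) :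
    IsTypeDefinableIn L κ {x | ∃ hx : x ∈ X, f ⟨x, hXW hx⟩ ∈ Y} := by
  obtain ⟨A, hA, S, hS, hXS⟩ := hX
  obtain ⟨A', hA', S', hS', hYS⟩ := hY
  obtain ⟨B, -, hB⟩ := Set.definable_iff_finitely_definable.1 hf
  set Γ : Set (Fin m ⊕ Fin n → R) := {p | ∃ x : W, p = Sum.elim x.1.1 (f x).1}
  refine ⟨(A ∪ A') ∪ B, mk_union_lt hκ ((Cardinal.mk_union_le A A').trans_lt
      (Cardinal.add_lt_of_lt hκ.le hA hA')) B.countable_toSet,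
    S ∪ (fun s => {x | ∃ y ∈ s, Sum.elim x y ∈ Γ}) '' S', ?_, ?_⟩
  · rintro _ (hs | ⟨s, hs, rfl⟩)
    · exact (hS _ hs).mono (Set.subset_union_left.trans Set.subset_union_left)
    · exact definable_relPreimage (hB.mono Set.subset_union_right)
        ((hS' s hs).mono (Set.subset_union_right.trans Set.subset_union_left))
  · rw [Set.sInter_union, ← hXS, Set.sInter_image]
    ext z
    constructor
    · rintro ⟨x, ⟨hx, hxY⟩, rfl⟩
      have hmem : (f ⟨x, hXW hx⟩).1 ∈ ⋂₀ S' := hYS ▸ ⟨_, hxY, rfl⟩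
      exact ⟨⟨x, hx, rfl⟩, Set.mem_iInter₂.2 fun s hs => ⟨_, hmem s hs, ⟨x, hXW hx⟩, rfl⟩⟩
    · rintro ⟨⟨x, hx, rfl⟩, h⟩
      have hmem : (f ⟨x, hXW hx⟩).1 ∈ ⋂₀ S' := by
        intro s hs
        obtain ⟨y, hy, x', hx'⟩ := Set.mem_iInter₂.1 h s hs
        obtain rfl : x = x'.1 := Subtype.ext (funext fun j => congrFun hx' (Sum.inl j))
        obtain rfl : y = (f x').1 := funext fun j => congrFun hx' (Sum.inr j)
        exact hy
      rw [← hYS] at hmem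
      obtain ⟨v, hv, hvf⟩ := hmem
      obtain rfl : v = f ⟨x, hXW hx⟩ := Subtype.ext hvf
      exact ⟨x, ⟨hx, hv⟩, rfl⟩

end DefinableMap

/-! ### Relative index and the main theorem -/

theorem mk_quotient_subgroupOf_top {G : Type w} [Group G] (K : Subgroup G) :
    #((⊤ : Subgroup G) ⧸ K.subgroupOf ⊤) = #(G ⧸ K) := by
  apply le_antisymm
  · refine mk_quotient_le_of_separates _ (fun x => (QuotientGroup.mk x.1 : G ⧸ K)) fun x y h => ?_
    exact Subgroup.mem_subgroupOf.2 (QuotientGroup.eq.1 h)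
  · refine mk_quotient_le_of_separates _ (fun x => (QuotientGroup.mk (⟨x, Subgroup.mem_top x⟩ :
      (⊤ : Subgroup G)) : (⊤ : Subgroup G) ⧸ K.subgroupOf ⊤)) fun x y h => ?_
    exact Subgroup.mem_subgroupOf.1 (QuotientGroup.eq.1 h)

theorem mk_quotient_subgroupOf_le_of_subset_mul {G : Type w} [Group G] {Q K : Subgroup G}
    {A : Set G} (h : (Q : Set G) ⊆ A * K) : #(Q ⧸ K.subgroupOf Q) ≤ #A := by
  choose a ha k hk hak using fun x : Q => h x.2
  refine mk_quotient_le_of_separates _ (fun x => (⟨a x, ha x⟩ : A)) fun x y hxy => ?_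
  have hxy' : a x = a y := congrArg Subtype.val hxy
  simp only at hak
  rw [Subgroup.mem_subgroupOf, Subgroup.coe_mul, Subgroup.coe_inv, ← hak x, ← hak y, hxy']
  simpa [mul_assoc] using mul_mem (inv_mem (hk x)) (hk y)

theorem proposition5p1 (L : FirstOrder.Language.{u, v}) (R : Type w) [Field R] [LinearOrder R]
    [IsStrictOrderedRing R] [IsRealClosed R] [L.Structure R]
    (hR : IsOMinimalExpansion L R)
    (κ : Cardinal.{w}) (hκ : ℵ₀ < κ) (hsat : IsSaturated L R κ)
    {m n : ℕ} (Z : Set (Fin m → R)) [Group Z] (hZ : IsLocallyDefinableGroup L Z)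
    (V : Set (Fin n → R)) [Group V] (hV : IsLocallyDefinableGroup L V)
    (Z00 : Subgroup Z) (hZ00 : IsZeroZero L κ ⊤ Z00)
    (W : Set Z) (hW : IsDefinableIn L W) (hZW : (Z00 : Set Z) ⊆ W)
    (θ : W → V) (hθdef : IsDefinableMap L θ) (hθ : IsLocalGroupHom θ) :
    ∃ W' : Set Z, IsDefinableIn L W' ∧ W'⁻¹ = W' ∧
      (Z00 : Set Z) ⊆ W' ∧ W' ⊆ W' * W' * W' * W' ∧ W' * W' * W' * W' ⊆ W ∧
      IsGenericIn L κ (Subgroup.closure (imageOn θ W')) (imageOn θ W') ∧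
      ∃ H : Subgroup V, (H : Set V) = imageOn θ (Z00 : Set Z) ∧
        IsTypeDefinableBoundedIndex L κ (Subgroup.closure (imageOn θ W')) H ∧
        (∃ K : Subgroup V, IsZeroZero L κ (Subgroup.closure (imageOn θ W')) K ∧ K ≤ H) ∧
        (H : Set V) ⊆ imageOn θ W' := by
  have hK := hZ00.1.2.1
  have hidx : #(Z ⧸ Z00) < κ := mk_quotient_subgroupOf_top Z00 ▸ hZ00.1.2.2
  obtain ⟨Y₁, hY₁, hKY₁, hY₁W, hY₁Y₁⟩ := hZ.exists_mul_self_subset hsat hκ hK hW hZW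
  obtain ⟨Y₂, hY₂, hKY₂, hY₂Y₁, hY₂Y₂⟩ := hZ.exists_mul_self_subset hsat hκ hK hY₁ hKY₁
  have hsub : Y₂ ∩ Y₂⁻¹ ⊆ Y₂ := Set.inter_subset_left
  have hdef : IsDefinableIn L (Y₂ ∩ Y₂⁻¹) := hZ.isDefinableIn_inter_inv hsat hκ hY₂
  have hinv : (Y₂ ∩ Y₂⁻¹)⁻¹ = Y₂ ∩ Y₂⁻¹ := by rw [Set.inter_inv, inv_inv, Set.inter_comm]
  have hKY : (Z00 : Set Z) ⊆ Y₂ ∩ Y₂⁻¹ := fun x hx => ⟨hKY₂ hx, hKY₂ (inv_mem hx)⟩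
  generalize Y₂ ∩ Y₂⁻¹ = Y at hsub hdef hinv hKY
  have hYY : Y * Y ⊆ Y₁ := (Set.mul_subset_mul hsub hsub).trans hY₂Y₂
  have h1Y : (1 : Z) ∈ Y := hKY (one_mem Z00)
  have hYW : Y ⊆ W := hsub.trans (hY₂Y₁.trans hY₁W)
  have h4 : Y * Y * Y * Y ⊆ W := by
    rw [mul_assoc (Y * Y)]
    exact (Set.mul_subset_mul hYY hYY).trans hY₁Y₁
  have hY4 : Y ⊆ Y * Y * Y * Y := fun x hx =>
    ⟨1 * 1 * 1, Set.mul_mem_mul (Set.mul_mem_mul h1Y h1Y) h1Y, x, hx, by simp⟩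
  have hrange := hθ.coe_range_restrict hZW
  have hHX : ((hθ.restrict hZW).range : Set V) ⊆ imageOn θ Y := hrange ▸ imageOn_mono hKY
  have hXinv := hθ.imageOn_inv (hYW h1Y) hYW hinv
  obtain ⟨B, hBG, hBκ, hB⟩ := hθ.exists_imageOn_mul_subset hZW hYW (hYY.trans hY₁W) h1Y
  have hC := mk_subgroupClosure_lt hκ (hBκ.trans_lt hidx)
  have hCG : Subgroup.closure B ≤ Subgroup.closure (imageOn θ Y) := (Subgroup.closure_le _).2 hBG
  have hcov := coe_closure_subset_closure_mul hXinv hHX hB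
  have hHG : (hθ.restrict hZW).range ≤ Subgroup.closure (imageOn θ Y) :=
    fun x hx => Subgroup.subset_closure (hHX hx)
  have hleft : (Subgroup.closure B : Set V) * imageOn θ Y = Subgroup.closure (imageOn θ Y) := by
    refine Set.Subset.antisymm ?_ (hcov.trans (Set.mul_subset_mul_left hHX))
    rintro _ ⟨c, hc, x, hx, rfl⟩
    exact mul_mem (hCG hc) (Subgroup.subset_closure hx)
  have hright : imageOn θ Y * (Subgroup.closure B : Set V) = Subgroup.closure (imageOn θ Y) := by
    -- Inversion fixes `X` and both generated subgroups and swaps left with right translates.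
    have := congrArg (·⁻¹) hleft
    simpa [hXinv] using this
  have hbdd : IsTypeDefinableBoundedIndex L κ (Subgroup.closure (imageOn θ Y))
      (hθ.restrict hZW).range :=
    ⟨hHG, hrange ▸ hθdef.isTypeDefinableIn_imageOn hsat hκ hK,
      (mk_quotient_subgroupOf_le_of_subset_mul hcov).trans_lt hC⟩
  refine ⟨Y, hdef, hinv, hKY, hY4, h4,
    ⟨hθdef.isDefinableIn_imageOn hdef, Subgroup.subset_closure, ⟨_, hCG, hC, hleft⟩,
      ⟨_, hCG, hC, hright⟩⟩, (hθ.restrict hZW).range, hrange, hbdd,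
    ⟨_, ⟨hbdd, fun K' hK' => ?_⟩, le_rfl⟩, hHX⟩
  have hN : Z00 ≤ (K'.comap (hθ.restrict hZW)).map Z00.subtype := by
    refine hZ00.2 _ ⟨le_top, ?_, ?_⟩
    · convert! hθdef.isTypeDefinableIn_preimage hκ hK hZW hK'.2.1 using 1
      ext x
      constructor
      · rintro ⟨y, hy, rfl⟩
        exact ⟨y.2, hy⟩
      · rintro ⟨hx, hxK⟩
        exact ⟨⟨x, hx⟩, hxK, rfl⟩
    · rw [mk_quotient_subgroupOf_top]
      exact hθ.mk_quotient_comap_lt hZW hκ.le hidx hHG hK'.2.2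
  rintro _ ⟨x, rfl⟩
  obtain ⟨y, hy, hyx⟩ := hN x.2
  obtain rfl : y = x := Subtype.ext hyx
  exact hy
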